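/- All graphs are finite, simple and undirected. Let $G=(V,E)$ be a graph and $S\subseteq V$. The set $S$ is a *connected dominating set* of $G$ if every vertex of $G$ is in $S$ or has a neighbor in $S$, and the induced subgraph $G[S]$ is connected (in particular, $S\neq\emptyset$). The set $S$ is a *total dominating set* of $G$ if every vertex of $G$ has a neighbor in $S$. The graph $G$ is *connected-domishold* (resp. *total domishold*) if there exist a weight function $w:V\to\mathbb{R}_{\ge 0}$ and a threshold $t\in\mathbb{R}_{\ge 0}$ such that for every $S\subseteq V$, $\sum_{x\in S}w(x)\ge t$ if and only if $S$ is a connected dominating set (resp. a total dominating set) of $G$. The graph $G$ is *hereditarily connected-domishold* (resp. *hereditarily total domishold*) if every induced subgraph of $G$ is connected-domishold (resp. total domishold). **Corollary.** Every hereditarily total domishold graph is hereditarily connected-domishold. -/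

import Mathlib

/-- `S` is a dominating set of `G`: every vertex is in `S` or has a neighbor in `S`. -/
def IsDominatingSet {V : Type*} (G : SimpleGraph V) (S : Set V) : Prop :=
  ∀ v : V, v ∈ S ∨ ∃ u ∈ S, G.Adj v u

/-- `S` is a connected dominating set of `G`: it is dominating and `G[S]` is connected. -/
def IsConnectedDominatingSet {V : Type*} (G : SimpleGraph V) (S : Set V) : Prop :=
  IsDominatingSet G S ∧ (G.induce S).Connected

/-- `S` is a total dominating set of `G`: every vertex has a neighbor in `S`. -/
def IsTotalDominatingSet {V : Type*} (G : SimpleGraph V) (S : Set V) : Prop :=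
  ∀ v : V, ∃ u ∈ S, G.Adj v u

/-- A (finite) graph is connected-domishold if there are non-negative real vertex weights `w` and a
non-negative threshold `t` such that the vertex sets of weight at least `t` are exactly the
connected dominating sets. As the graphs are finite, the vertex sets are the finsets. -/
def IsConnectedDomishold {V : Type*} (G : SimpleGraph V) : Prop :=
  ∃ (w : V → ℝ) (t : ℝ), (∀ v, 0 ≤ w v) ∧ 0 ≤ t ∧
    ∀ S : Finset V, t ≤ ∑ x ∈ S, w x ↔ IsConnectedDominatingSet G (S : Set V)

/-- A (finite) graph is total domishold if there are non-negative real vertex weights `w` and a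
non-negative threshold `t` such that the vertex sets of weight at least `t` are exactly the
total dominating sets. -/
def IsTotalDomishold {V : Type*} (G : SimpleGraph V) : Prop :=
  ∃ (w : V → ℝ) (t : ℝ), (∀ v, 0 ≤ w v) ∧ 0 ≤ t ∧
    ∀ S : Finset V, t ≤ ∑ x ∈ S, w x ↔ IsTotalDominatingSet G (S : Set V)

/-- Every induced subgraph of `G` is connected-domishold. -/
def IsHereditarilyConnectedDomishold {V : Type*} (G : SimpleGraph V) : Prop :=
  ∀ U : Set V, IsConnectedDomishold (G.induce U)

/-- Every induced subgraph of `G` is total domishold. -/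
def IsHereditarilyTotalDomishold {V : Type*} (G : SimpleGraph V) : Prop :=
  ∀ U : Set V, IsTotalDomishold (G.induce U)

/-! Connected dominating sets are closed under supersets, so a set is one exactly when its
complement contains no hyperedge of the family H of minimal sets whose complement is not one. A
linear separation for H therefore yields the required weights by complementation. It exists whenever
H is 1-Sperner (`IsOneSperner.exists_isThresholdFor`): such a hypergraph splits at a vertex into two
smaller ones whose weights combine.

The graph enters through three patterns, excluded by exchanging vertices between total dominating
sets (`IsHereditarilyTotalDomishold.patternFree`). If H has at least two hyperedges, each is a
separator with two full components, hence a clique, and any two of its vertices have a common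
neighbor in each full component. Hyperedges S and T with two private vertices each would then create
the pattern `private_pairs` (`HasTwoFullComponents.not_two_two`). Pattern-freeness passes to induced
subgraphs, which makes the conclusion hereditary. -/

/-! ### 1-Sperner hypergraphs are threshold. -/

/-- A finite hypergraph is 1-Sperner if of any two distinct hyperedges, each has a vertex outside the
other, and one of them has only one such vertex. -/
def IsOneSperner {V : Type*} [DecidableEq V] (H : Finset (Finset V)) : Prop :=
  ∀ e ∈ H, ∀ f ∈ H, e ≠ f → min (e \ f).card (f \ e).card = 1

/-- Positive weights `w` and a threshold `t` that separate the sets containing a hyperedge of `H` from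
those that contain none. -/
def IsThresholdFor {V : Type*} (H : Finset (Finset V)) (w : V → ℝ) (t : ℝ) : Prop :=
  (∀ v, 0 < w v) ∧ 0 ≤ t ∧ ∀ X : Finset V, t ≤ ∑ x ∈ X, w x ↔ ∃ e ∈ H, e ⊆ X

/-- Missing one vertex of `e` costs `N`, more than all the unit weights together can make up. -/
lemma exists_isThresholdFor_singleton {V : Type*} [Fintype V] [DecidableEq V] (e : Finset V) :
    ∃ w t, IsThresholdFor {e} w t := by
  set N : ℝ := Fintype.card V + 1 with hN
  have hN0 : 0 < N := by positivity
  have hsum (X : Finset V) : ∑ x ∈ X, (1 + if x ∈ e then N else 0) =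
      (X.card : ℝ) + N * ((X ∩ e).card : ℝ) := by
    rw [Finset.sum_add_distrib, ← Finset.sum_filter, Finset.filter_mem_eq_inter]
    simp [mul_comm]
  refine ⟨fun x => 1 + if x ∈ e then N else 0, N * e.card, fun v => ?_,
    by positivity, fun X => ?_⟩
  · dsimp only; split_ifs <;> positivity
  rw [hsum]
  simp only [Finset.mem_singleton, exists_eq_left]
  constructor
  · intro h
    by_contra hX
    have h1 : (X ∩ e).card < e.card := Finset.card_lt_card
      ⟨Finset.inter_subset_right, fun h' => hX (h'.trans Finset.inter_subset_left)⟩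
    have h2 : ((X ∩ e).card : ℝ) + 1 ≤ e.card := by exact_mod_cast h1
    have h3 : (X.card : ℝ) ≤ Fintype.card V := by exact_mod_cast Finset.card_le_univ X
    nlinarith
  · intro h
    rw [Finset.inter_eq_right.mpr h]
    have : (0 : ℝ) ≤ X.card := by positivity
    linarith

/-- The weights of a hypergraph glued from two smaller ones along a vertex `v`: its hyperedges through
`v` live on `insert v A`, and those that avoid `v` contain `A`. -/
lemma exists_isThresholdFor_of_glue {V : Type*} [Fintype V] [DecidableEq V] {H : Finset (Finset V)}
    {v : V} {A : Finset V} (hvA : v ∉ A) (hA : ∀ e ∈ H, v ∈ e → e.erase v ⊆ A)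
    (hA' : ∀ e ∈ H, v ∉ e → A ⊆ e) (hv : ∃ e ∈ H, v ∈ e)
    {w₁ w₂ : V → ℝ} {t₁ t₂ : ℝ}
    (h₁ : IsThresholdFor ((H.filter (v ∈ ·)).image (·.erase v)) w₁ t₁)
    (h₂ : IsThresholdFor ((H.filter (v ∉ ·)).image (· \ A)) w₂ t₂) :
    ∃ w t, IsThresholdFor H w t := by
  obtain ⟨hw₁, ht₁, h₁⟩ := h₁
  obtain ⟨hw₂, ht₂, h₂⟩ := h₂
  simp only [Finset.mem_image, Finset.mem_filter, exists_exists_and_eq_and] at h₁ h₂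
  simp only [and_assoc] at h₁ h₂
  have htA : t₁ ≤ ∑ x ∈ A, w₁ x := by
    obtain ⟨e, he, hve⟩ := hv
    exact (h₁ A).2 ⟨e, he, hve, hA e he hve⟩
  set C : ℝ := ∑ x, w₂ x + 1 with hC
  have large (c : ℝ) : ∀ᶠ M : ℝ in Filter.atTop, 0 < c → C < M * c := by
    by_cases hc : 0 < c
    · filter_upwards [(Filter.tendsto_id.atTop_mul_const hc).eventually_gt_atTop C] with M hM _
      exact hM
    · exact Filter.Eventually.of_forall fun _ h => absurd h hc
  -- `M` makes each of the finitely many positive deficits on `A` outweigh the whole of `w₂`.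
  obtain ⟨M, hM0, hM₁, hM₂⟩ := ((Filter.eventually_gt_atTop (0 : ℝ)).and
    ((Filter.eventually_all.2 fun X : Finset V => large (t₁ - ∑ x ∈ X ∩ A, w₁ x)).and
    (Filter.eventually_all.2 fun X : Finset V =>
      large (∑ x ∈ A, w₁ x - ∑ x ∈ X ∩ A, w₁ x)))).exists
  set a := ∑ x ∈ A, w₁ x
  -- With `v` present, the threshold `M * a + t₂` drops to `M * t₁`, up to the extra 1. That 1 only
  -- ensures positivity; `C` absorbs it.
  set wv : ℝ := M * (a - t₁) + t₂ + 1
  have hwv : 0 < wv := by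
    have := mul_nonneg hM0.le (sub_nonneg.2 htA)
    simp only [wv]; linarith
  set w : V → ℝ := fun x => if x = v then wv else if x ∈ A then M * w₁ x else w₂ x with hw
  have ha : 0 ≤ a := Finset.sum_nonneg fun x _ => (hw₁ x).le
  have split (X : Finset V) : ∑ x ∈ X, w x = (if v ∈ X then wv else 0) +
      (M * ∑ x ∈ X ∩ A, w₁ x + ∑ x ∈ (X.erase v) \ A, w₂ x) := by
    have e1 : ∑ x ∈ X.erase v, w x =
        M * ∑ x ∈ X ∩ A, w₁ x + ∑ x ∈ (X.erase v) \ A, w₂ x := by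
      rw [← Finset.sum_inter_add_sum_sdiff (X.erase v) A, Finset.mul_sum]
      congr 1
      · have : X.erase v ∩ A = X ∩ A := by
          ext x; simp only [Finset.mem_inter, Finset.mem_erase]
          constructor
          · rintro ⟨⟨_, h⟩, h'⟩; exact ⟨h, h'⟩
          · rintro ⟨h, h'⟩; exact ⟨⟨fun h'' => hvA (h'' ▸ h'), h⟩, h'⟩
        rw [this]
        refine Finset.sum_congr rfl fun x hx => ?_
        have hx := (Finset.mem_inter.1 hx).2
        have : x ≠ v := fun h => hvA (h ▸ hx)
        simp [hw, this, hx]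
      · refine Finset.sum_congr rfl fun x hx => ?_
        simp only [Finset.mem_sdiff, Finset.mem_erase] at hx
        simp [hw, hx.1.1, hx.2]
    rw [← e1]
    split_ifs with hX
    · rw [← Finset.add_sum_erase X w hX]; simp [hw]
    · rw [Finset.erase_eq_of_notMem hX]; simp
  have hw₂X (X : Finset V) : ∑ x ∈ X, w₂ x ≤ C - 1 := by
    rw [hC, add_sub_cancel_right]
    exact Finset.sum_le_sum_of_subset_of_nonneg (Finset.subset_univ _) fun x _ _ => (hw₂ x).le
  have hw₂X' (X : Finset V) : 0 ≤ ∑ x ∈ X, w₂ x := Finset.sum_nonneg fun x _ => (hw₂ x).le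
  refine ⟨w, M * a + t₂, fun x => ?_, by positivity, fun X => ?_⟩
  · have := hw₁ x
    have := hw₂ x
    simp only [hw]; split_ifs <;> positivity
  rw [split]
  have hmono : ∑ x ∈ X ∩ A, w₁ x ≤ a := Finset.sum_le_sum_of_subset_of_nonneg
    Finset.inter_subset_right fun x _ _ => (hw₁ x).le
  have hY := hw₂X (X.erase v \ A)
  have hY' := hw₂X' (X.erase v \ A)
  by_cases hX : v ∈ X
  · rw [if_pos hX]
    have key : (M * a + t₂ ≤ wv + (M * ∑ x ∈ X ∩ A, w₁ x + ∑ x ∈ X.erase v \ A, w₂ x)) ↔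
        t₁ ≤ ∑ x ∈ X ∩ A, w₁ x := by
      constructor
      · intro h
        by_contra! hlt
        have := hM₁ X (sub_pos.2 hlt)
        simp only [wv] at h
        nlinarith
      · intro h
        simp only [wv]
        nlinarith
    rw [key, h₁]
    constructor
    · rintro ⟨e, he, hve, hs⟩
      refine ⟨e, he, fun x hx => ?_⟩
      by_cases hxv : x = v
      · exact hxv ▸ hX
      · exact Finset.inter_subset_left (hs (Finset.mem_erase.2 ⟨hxv, hx⟩))
    · rintro ⟨e, he, hs⟩
      by_cases hve : v ∈ e
      · exact ⟨e, he, hve, Finset.subset_inter ((Finset.erase_subset _ _).trans hs) (hA e he hve)⟩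
      · refine (h₁ _).1 ?_
        rw [Finset.inter_eq_right.2 ((hA' e he hve).trans hs)]
        exact htA
  · rw [if_neg hX, zero_add, Finset.erase_eq_of_notMem hX]
    rw [Finset.erase_eq_of_notMem hX] at hY hY'
    by_cases hAX : A ⊆ X
    · rw [Finset.inter_eq_right.2 hAX, add_le_add_iff_left, h₂]
      constructor
      · rintro ⟨e, he, hve, hs⟩
        refine ⟨e, he, fun x hx => ?_⟩
        by_cases hxA : x ∈ A
        · exact hAX hxA
        · exact Finset.sdiff_subset (hs (Finset.mem_sdiff.2 ⟨hx, hxA⟩))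
      · rintro ⟨e, he, hs⟩
        exact ⟨e, he, fun h => hX (hs h), Finset.sdiff_subset_sdiff hs le_rfl⟩
    · refine iff_of_false ?_ ?_
      · obtain ⟨y, hyA, hyX⟩ := Finset.not_subset.1 hAX
        have hlt : ∑ x ∈ X ∩ A, w₁ x < a := Finset.sum_lt_sum_of_subset Finset.inter_subset_right
          hyA (fun h => hyX (Finset.mem_inter.1 h).1) (hw₁ y) fun x _ _ => (hw₁ x).le
        have := hM₂ X (sub_pos.2 hlt)
        intro h
        nlinarith
      · rintro ⟨e, he, hs⟩
        exact hAX ((hA' e he fun h => hX (hs h)).trans hs)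

lemma IsOneSperner.not_subset {V : Type*} [DecidableEq V] {H : Finset (Finset V)}
    (hH : IsOneSperner H) {e f : Finset V} (he : e ∈ H) (hf : f ∈ H) (hne : e ≠ f) : ¬ e ⊆ f := by
  intro h
  have := hH e he f hf hne
  rw [Finset.sdiff_eq_empty_iff_subset.2 h] at this
  simp at this

/-- Being 1-Sperner depends only on the differences of hyperedges, so deleting common vertices
preserves it. -/
lemma IsOneSperner.image {V : Type*} [DecidableEq V] {H H' : Finset (Finset V)}
    (hH : IsOneSperner H) (hH' : H' ⊆ H) (φ : Finset V → Finset V)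
    (hφ : ∀ e ∈ H', ∀ f ∈ H', φ e \ φ f = e \ f) : IsOneSperner (H'.image φ) := by
  intro e he f hf hne
  rw [Finset.mem_image] at he hf
  obtain ⟨e, he, rfl⟩ := he
  obtain ⟨f, hf, rfl⟩ := hf
  rw [hφ e he f hf, hφ f hf e he]
  exact hH e (hH' he) f (hH' hf) fun h => hne (h ▸ rfl)

/-- A 1-Sperner hypergraph with at least two hyperedges is glued along some vertex. -/
lemma IsOneSperner.exists_glue {V : Type*} [DecidableEq V] {H : Finset (Finset V)}
    (hH : IsOneSperner H) (hcard : 1 < H.card) :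
    ∃ v, (∃ e ∈ H, v ∈ e) ∧ (∃ e ∈ H, v ∉ e) ∧
      ∀ e ∈ H, v ∈ e → ∀ f ∈ H, v ∉ f → e.erase v ⊆ f := by
  -- By maximality of `m`, every other hyperedge has exactly one vertex outside `m`.
  obtain ⟨m, hm, hmax⟩ := H.exists_max_image Finset.card (Finset.card_pos.1 (by omega))
  have out : ∀ f ∈ H, f ≠ m → ∃ x, f \ m = {x} := by
    intro f hf hne
    have h1 := hH f hf m hm hne
    have h2 : (f \ m).card ≤ (m \ f).card := Finset.card_sdiff_le_card_sdiff_iff.2 (hmax f hf)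
    rw [min_eq_left h2] at h1
    exact Finset.card_eq_one.1 h1
  -- The gluing vertex is the one vertex outside `m` of a hyperedge whose trace on `m` is smallest.
  obtain ⟨g, hg, hmin⟩ := (H.erase m).exists_min_image (fun f => (f ∩ m).card)
    (Finset.card_pos.1 (by rw [Finset.card_erase_of_mem hm]; omega))
  obtain ⟨hgm, hg⟩ := Finset.mem_erase.1 hg
  obtain ⟨v, hv⟩ := out g hg hgm
  have hvg : v ∈ g \ m := hv ▸ Finset.mem_singleton_self v
  obtain ⟨hvg, hvm⟩ := Finset.mem_sdiff.1 hvg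
  have nested : ∀ e ∈ H, v ∈ e → ∀ f ∈ H, v ∉ f → f ≠ m → e ∩ m ⊆ f ∩ m ∨ f ∩ m ⊆ e ∩ m := by
    intro e he hve f hf hvf hfm
    obtain ⟨x, hx⟩ := out e he fun h => hvm (h ▸ hve)
    obtain ⟨y, hy⟩ := out f hf hfm
    have hxv : v = x := Finset.mem_singleton.1 (hx ▸ Finset.mem_sdiff.2 ⟨hve, hvm⟩)
    subst hxv
    have hyf : y ∈ f \ m := hy ▸ Finset.mem_singleton_self y
    obtain ⟨hyf, hym⟩ := Finset.mem_sdiff.1 hyf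
    have hye : y ∉ e := fun h => hvf
      (Finset.mem_singleton.1 (hx ▸ Finset.mem_sdiff.2 ⟨h, hym⟩ : y ∈ {v}) ▸ hyf)
    by_contra! hcon
    obtain ⟨⟨p, hp, hp'⟩, ⟨q, hq, hq'⟩⟩ := hcon.imp Finset.not_subset.1 Finset.not_subset.1
    rw [Finset.mem_inter] at hp hp' hq hq'
    have hpf : p ∉ f := fun h => hp' ⟨h, hp.2⟩
    have hqe : q ∉ e := fun h => hq' ⟨h, hq.2⟩
    have h1 : 1 < (e \ f).card := Finset.one_lt_card.2 ⟨v, Finset.mem_sdiff.2 ⟨hve, hvf⟩, p,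
      Finset.mem_sdiff.2 ⟨hp.1, hpf⟩, fun h => hvm (h ▸ hp.2)⟩
    have h2 : 1 < (f \ e).card := Finset.one_lt_card.2 ⟨y, Finset.mem_sdiff.2 ⟨hyf, hye⟩, q,
      Finset.mem_sdiff.2 ⟨hq.1, hqe⟩, fun h => hym (h ▸ hq.2)⟩
    have := hH e he f hf fun h => hvf (h ▸ hve)
    omega
  have antichain : ∀ e ∈ H, v ∈ e → g ∩ m ⊆ e ∩ m → g = e := by
    intro e he hve hs
    by_contra hne
    refine hH.not_subset hg he hne fun z hz => ?_
    by_cases hzm : z ∈ m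
    · exact (Finset.mem_inter.1 (hs (Finset.mem_inter.2 ⟨hz, hzm⟩))).1
    · have : z ∈ ({v} : Finset V) := hv ▸ Finset.mem_sdiff.2 ⟨hz, hzm⟩
      exact Finset.mem_singleton.1 this ▸ hve
  refine ⟨v, ⟨g, hg, hvg⟩, ⟨m, hm, hvm⟩, fun e he hve f hf hvf => ?_⟩
  have hem : e.erase v ⊆ e ∩ m := by
    obtain ⟨x, hx⟩ := out e he fun h => hvm (h ▸ hve)
    have hxv : v = x := Finset.mem_singleton.1 (hx ▸ Finset.mem_sdiff.2 ⟨hve, hvm⟩)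
    intro z hz
    obtain ⟨hzv, hz⟩ := Finset.mem_erase.1 hz
    by_contra hzm
    have : z ∈ e \ m := Finset.mem_sdiff.2 ⟨hz, fun h => hzm (Finset.mem_inter.2 ⟨hz, h⟩)⟩
    rw [hx, ← hxv, Finset.mem_singleton] at this
    exact hzv this
  by_cases hfm : f = m
  · exact hem.trans (hfm ▸ Finset.inter_subset_right)
  refine hem.trans (Finset.Subset.trans ?_ (Finset.inter_subset_left (s₁ := f) (s₂ := m)))
  have hgf : g ∩ m ⊆ f ∩ m := by
    rcases nested g hg hvg f hf hvf hfm with h | h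
    · exact h
    · exact (Finset.eq_of_subset_of_card_le h (hmin f (Finset.mem_erase.2 ⟨hfm, hf⟩))).ge
  rcases nested e he hve f hf hvf hfm with h | h
  · exact h
  · rwa [antichain e he hve (hgf.trans h)] at hgf

theorem IsOneSperner.exists_isThresholdFor {V : Type*} [Fintype V] [DecidableEq V]
    {H : Finset (Finset V)} (hH : IsOneSperner H) : ∃ w t, IsThresholdFor H w t := by
  induction hn : H.card using Nat.strong_induction_on generalizing H with
  | _ n ih =>
  subst hn
  rcases Nat.lt_trichotomy H.card 1 with h0 | h1 | h2
  · rw [Finset.card_eq_zero.1 (Nat.lt_one_iff.1 h0)]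
    refine ⟨fun _ => 1, Fintype.card V + 1, fun _ => one_pos, by positivity, fun X => ?_⟩
    have : (X.card : ℝ) ≤ Fintype.card V := by exact_mod_cast Finset.card_le_univ X
    simp only [Finset.sum_const, nsmul_eq_mul, mul_one, Finset.notMem_empty, false_and, exists_false,
      iff_false, not_le]
    linarith
  · obtain ⟨e, rfl⟩ := Finset.card_eq_one.1 h1
    exact exists_isThresholdFor_singleton e
  obtain ⟨v, ⟨g, hg, hvg⟩, ⟨m, hm, hvm⟩, hglue⟩ := hH.exists_glue h2
  set A : Finset V := (H.filter (v ∈ ·)).biUnion (·.erase v) with hA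
  have memA : ∀ e ∈ H, v ∈ e → e.erase v ⊆ A := fun e he hve =>
    Finset.subset_biUnion_of_mem (fun e : Finset V => e.erase v)
      (Finset.mem_filter.2 ⟨he, hve⟩)
  have subA : ∀ f ∈ H, v ∉ f → A ⊆ f := fun f hf hvf => Finset.biUnion_subset.2 fun e he =>
    hglue e (Finset.mem_filter.1 he).1 (Finset.mem_filter.1 he).2 f hf hvf
  have card₁ : (H.filter (v ∈ ·)).card < H.card :=
    Finset.card_lt_card (Finset.filter_ssubset.2 ⟨m, hm, hvm⟩)
  have card₂ : (H.filter (v ∉ ·)).card < H.card :=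
    Finset.card_lt_card (Finset.filter_ssubset.2 ⟨g, hg, not_not.2 hvg⟩)
  obtain ⟨w₁, t₁, h₁⟩ := ih _ (Finset.card_image_le.trans_lt card₁)
    (hH.image (Finset.filter_subset (v ∈ ·) H) (·.erase v) fun e he f hf => by
      ext x
      have := (Finset.mem_filter.1 hf).2
      simp only [Finset.mem_sdiff, Finset.mem_erase]
      grind) rfl
  obtain ⟨w₂, t₂, h₂⟩ := ih _ (Finset.card_image_le.trans_lt card₂)
    (hH.image (Finset.filter_subset (v ∉ ·) H) (· \ A) fun e he f hf => by
      ext x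
      obtain ⟨hf, hvf⟩ := Finset.mem_filter.1 hf
      have : x ∈ A → x ∈ f := fun h => subA f hf hvf h
      simp only [Finset.mem_sdiff]
      tauto) rfl
  refine exists_isThresholdFor_of_glue (v := v) (A := A) ?_ memA subA ⟨g, hg, hvg⟩ h₁ h₂
  simp [hA]

/-! ### Forbidden patterns from total domination. -/

/-- Absence of three induced patterns: the cycles on four and on five vertices, and two nonadjacent
vertices `a`, `b` with two private neighbors each. -/
structure PatternFree {V : Type*} (G : SimpleGraph V) : Prop where
  four_cycle : ∀ a b c d, G.Adj a b → G.Adj b c → G.Adj c d → G.Adj d a →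
    a ≠ c → b ≠ d → ¬ G.Adj a c → ¬ G.Adj b d → False
  five_cycle : ∀ a b c d e, G.Adj a b → G.Adj b c → G.Adj c d → G.Adj d e → G.Adj e a →
    ¬ G.Adj a c → ¬ G.Adj b d → ¬ G.Adj c e → ¬ G.Adj d a → ¬ G.Adj e b → False
  private_pairs : ∀ a b p q r s, G.Adj a p → G.Adj a q → G.Adj b r → G.Adj b s → p ≠ q → r ≠ s →
    ¬ G.Adj a b → ¬ G.Adj a r → ¬ G.Adj a s → ¬ G.Adj b p → ¬ G.Adj b q → False

lemma PatternFree.induce {V : Type*} {G : SimpleGraph V} (hG : PatternFree G) (U : Set V) :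
    PatternFree (G.induce U) where
  four_cycle a b c d h₁ h₂ h₃ h₄ h₅ h₆ h₇ h₈ := hG.four_cycle a b c d h₁ h₂ h₃ h₄
    (fun h => h₅ (Subtype.ext h)) (fun h => h₆ (Subtype.ext h)) h₇ h₈
  five_cycle a b c d e := hG.five_cycle a b c d e
  private_pairs a b p q r s h₁ h₂ h₃ h₄ h₅ h₆ := hG.private_pairs a b p q r s h₁ h₂ h₃ h₄
    (fun h => h₅ (Subtype.ext h)) (fun h => h₆ (Subtype.ext h))

/-- In a hereditarily total domishold graph, sets dominating `U` cannot be exchanged into two sets that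
both fail to dominate `U`. -/
lemma IsHereditarilyTotalDomishold.exchange {V : Type*} {G : SimpleGraph V}
    (hG : IsHereditarilyTotalDomishold G) {U X Y C D : Finset V}
    (hXU : X ⊆ U) (hYU : Y ⊆ U) (hCU : C ⊆ U) (hDU : D ⊆ U)
    (hX : ∀ v ∈ U, ∃ u ∈ X, G.Adj v u) (hY : ∀ v ∈ U, ∃ u ∈ Y, G.Adj v u)
    (hsum : ∀ w : V → ℝ, ∑ x ∈ X, w x + ∑ x ∈ Y, w x = ∑ x ∈ C, w x + ∑ x ∈ D, w x) :
    (∀ v ∈ U, ∃ u ∈ C, G.Adj v u) ∨ (∀ v ∈ U, ∃ u ∈ D, G.Adj v u) := by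
  classical
  obtain ⟨w, t, -, -, h⟩ := hG U
  set w' : V → ℝ := fun v => if hv : v ∈ (U : Set V) then w ⟨v, hv⟩ else 0 with hw'
  have key : ∀ S : Finset V, S ⊆ U → (t ≤ ∑ x ∈ S, w' x ↔ ∀ v ∈ U, ∃ u ∈ S, G.Adj v u) := by
    intro S hS
    have e : ∑ x ∈ S, w' x = ∑ x ∈ S.subtype (· ∈ (U : Set V)), w x := by
      rw [← Finset.sum_subtype_of_mem w' (p := (· ∈ (U : Set V))) fun x hx => hS hx]
      exact Finset.sum_congr rfl fun x _ => by simp [hw']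
    rw [e, h]
    constructor
    · intro hd v hv
      obtain ⟨u, hu, hadj⟩ := hd ⟨v, hv⟩
      exact ⟨u, by simpa using hu, hadj⟩
    · rintro hd ⟨v, hv⟩
      obtain ⟨u, hu, hadj⟩ := hd v hv
      exact ⟨⟨u, hS hu⟩, by simpa using hu, hadj⟩
  rw [← key X hXU] at hX
  rw [← key Y hYU] at hY
  rw [← key C hCU, ← key D hDU]
  by_contra! hcon
  linarith [hsum w']

/-- On each pattern, two total dominating sets can be redistributed into two sets that each leave
some vertex without a neighbor. -/
lemma IsHereditarilyTotalDomishold.patternFree {V : Type*} {G : SimpleGraph V}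
    (hG : IsHereditarilyTotalDomishold G) : PatternFree G where
  four_cycle a b c d hab hbc hcd hda hac hbd nac nbd := by
    classical
    have := hG.exchange (U := {a, b, c, d}) (X := {a, b}) (Y := {c, d}) (C := {a, c}) (D := {b, d})
      (by grind) (by grind) (by grind) (by grind)
      (by simp [hab, hab.symm, hbc.symm, hda]) (by simp [hcd, hcd.symm, hda.symm, hbc])
      (fun w => by
        rw [Finset.sum_pair hab.ne, Finset.sum_pair hcd.ne, Finset.sum_pair hac,
          Finset.sum_pair hbd]; ring)
    rcases this with h | h
    · simpa [nac] using h a (by simp)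
    · simpa [nbd] using h b (by simp)
  five_cycle a b c d e hab hbc hcd hde hea nac nbd nce nda neb := by
    classical
    have hac : a ≠ c := fun h => nda (h ▸ hcd.symm)
    have hbd : b ≠ d := fun h => neb (h ▸ hde.symm)
    have hce : c ≠ e := fun h => nac (h ▸ hea.symm)
    have hda : d ≠ a := fun h => nbd (h ▸ hab.symm)
    have heb : e ≠ b := fun h => nce (h ▸ hbc.symm)
    have := hG.exchange (U := {a, b, c, d, e}) (X := {a, b, c}) (Y := {c, d, e})
      (C := {a, c, d}) (D := {b, c, e})
      (by grind) (by grind) (by grind) (by grind)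
      (by simp [hab, hab.symm, hbc, hbc.symm, hcd.symm, hea])
      (by simp [hcd, hcd.symm, hea.symm, hbc, hde, hde.symm])
      (fun w => by
        simp [hab.ne, hac, hbc.ne, hcd.ne, hde.ne, hce, hda.symm, heb.symm]; ring)
    have nac' : ¬ G.Adj c a := fun h => nac h.symm
    have nad' : ¬ G.Adj a d := fun h => nda h.symm
    have nec' : ¬ G.Adj e c := fun h => nce h.symm
    rcases this with h | h
    · simpa [nac, nad'] using h a (by simp)
    · simpa [neb, nec'] using h e (by simp)
  private_pairs a b p q r s hap haq hbr hbs hpq hrs nab nar nas nbp nbq := by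
    classical
    have hab : a ≠ b := fun h => nar (h ▸ hbr)
    have har : a ≠ r := fun h => nab (h ▸ hbr.symm)
    have has : a ≠ s := fun h => nab (h ▸ hbs.symm)
    have hbp : b ≠ p := fun h => nab (h ▸ hap)
    have hbq : b ≠ q := fun h => nab (h ▸ haq)
    have hpr : p ≠ r := fun h => nar (h ▸ hap)
    have hqs : q ≠ s := fun h => nas (h ▸ haq)
    have := hG.exchange (U := {a, b, p, q, r, s}) (X := {a, b, p, r}) (Y := {a, b, q, s})
      (C := {a, b, p, q}) (D := {a, b, r, s})
      (by grind) (by grind) (by grind) (by grind)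
      (by simp [hap, hap.symm, haq.symm, hbr, hbr.symm, hbs.symm])
      (by simp [haq, haq.symm, hap.symm, hbs, hbs.symm, hbr.symm])
      (fun w => by
        simp [hap.ne, haq.ne, hbr.ne, hbs.ne, hab, har, has, hbp, hbq, hpr, hqs, hpq, hrs]
        ring)
    have nba : ¬ G.Adj b a := fun h => nab h.symm
    rcases this with h | h
    · simpa [nba, nbp, nbq] using h b (by simp)
    · simpa [nab, nar, nas] using h a (by simp)

/-! ### Separators with two full components. -/

/-- `K` is the vertex set of a connected component of `G - S`, and every vertex of `S` has a neighbor
in it. -/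
structure IsFullComponent {V : Type*} (G : SimpleGraph V) (S K : Set V) : Prop where
  nonempty : K.Nonempty
  disjoint : ∀ v ∈ K, v ∉ S
  closed : ∀ u ∈ K, ∀ v, v ∉ S → G.Adj u v → v ∈ K
  cut : ∀ A ⊆ K, A.Nonempty → ¬ K ⊆ A → ∃ x ∈ A, ∃ y ∈ K, y ∉ A ∧ G.Adj x y
  full : ∀ s ∈ S, ∃ k ∈ K, G.Adj s k

/-- Two vertices of `S` without a common neighbor in `K` are joined by an induced path with two or
three inner vertices, all in `K`. -/
lemma IsFullComponent.short_path {V : Type*} {G : SimpleGraph V} (hG : PatternFree G) {S K : Set V}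
    (hK : IsFullComponent G S K) {s t : V} (hs : s ∈ S) (ht : t ∈ S)
    (hno : ∀ k ∈ K, G.Adj s k → ¬ G.Adj t k) :
    (∃ x ∈ K, ∃ y ∈ K, G.Adj s x ∧ G.Adj t y ∧ G.Adj x y) ∨
    ∃ x ∈ K, ∃ z ∈ K, ∃ y ∈ K, G.Adj s x ∧ G.Adj x z ∧ G.Adj z y ∧ G.Adj t y ∧
      ¬ G.Adj s z ∧ ¬ G.Adj t z ∧ ¬ G.Adj x y := by
  by_contra! hcon
  obtain ⟨h1, h2⟩ := hcon
  obtain ⟨k, hk, hsk⟩ := hK.full s hs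
  obtain ⟨l, hl, htl⟩ := hK.full t ht
  -- Take an edge `x p` leaving the neighborhood of `s` in `K`, and `y q` likewise for `t`. Without
  -- a short path, `x` with `s, p` and `y` with `t, q` form `private_pairs`.
  obtain ⟨x, ⟨hxK, hsx⟩, p, hp, hpn, hxp⟩ := hK.cut {v | v ∈ K ∧ G.Adj s v} (fun v h => h.1)
    ⟨k, hk, hsk⟩ fun h => hno l hl (h hl).2 htl
  obtain ⟨y, ⟨hyK, hty⟩, q, hq, hqn, hyq⟩ := hK.cut {v | v ∈ K ∧ G.Adj t v} (fun v h => h.1)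
    ⟨l, hl, htl⟩ fun h => hno k hk hsk (h hk).2
  have hsp : ¬ G.Adj s p := fun h => hpn ⟨hp, h⟩
  have htq : ¬ G.Adj t q := fun h => hqn ⟨hq, h⟩
  have htp : ¬ G.Adj t p := fun h => h1 x hxK p hp hsx h hxp
  have hsq : ¬ G.Adj s q := fun h => h1 q hq y hyK h hty hyq.symm
  have hxy : ¬ G.Adj x y := h1 x hxK y hyK hsx hty
  have hxq : ¬ G.Adj x q := fun h => hxy (h2 x hxK q hq y hyK hsx h hyq.symm hty hsq htq)
  have hyp : ¬ G.Adj y p := fun h => hxy (h2 x hxK p hp y hyK hsx hxp h.symm hty hsp htp)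
  refine hG.private_pairs x y s p t q hsx.symm hxp hty.symm hyq ?_ ?_ hxy ?_ hxq ?_ hyp
  · exact fun h => hK.disjoint p hp (h ▸ hs)
  · exact fun h => hK.disjoint q hq (h ▸ ht)
  · exact fun h => hno x hxK hsx h.symm
  · exact fun h => hno y hyK h.symm hty

lemma IsFullComponent.not_adj {V : Type*} {G : SimpleGraph V} {S K L : Set V}
    (hK : IsFullComponent G S K) (hL : IsFullComponent G S L) (hKL : Disjoint K L) {x y : V}
    (hx : x ∈ K) (hy : y ∈ L) : ¬ G.Adj x y := fun h =>
  Set.disjoint_left.1 hKL (hK.closed x hx y (hL.disjoint y hy) h) hy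

/-- If `s` and `t` were nonadjacent, `c` and a short path through `K` would close an induced cycle
of length 4, 5 or 6; the last contains `private_pairs`. -/
lemma IsFullComponent.adj_of_common {V : Type*} {G : SimpleGraph V} (hG : PatternFree G)
    {S K L : Set V} (hK : IsFullComponent G S K) (hL : IsFullComponent G S L) (hKL : Disjoint K L)
    {s t c : V} (hs : s ∈ S) (ht : t ∈ S) (hst : s ≠ t) (hc : c ∈ L) (hsc : G.Adj s c)
    (htc : G.Adj t c) : G.Adj s t := by
  have hcK : ∀ x ∈ K, ¬ G.Adj c x := fun x hx h => hK.not_adj hL hKL hx hc h.symm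
  have hcx : ∀ x ∈ K, c ≠ x := fun x hx h => Set.disjoint_left.1 hKL hx (h ▸ hc)
  by_contra hn
  by_cases hno : ∃ k ∈ K, G.Adj s k ∧ G.Adj t k
  · obtain ⟨k, hk, hsk, htk⟩ := hno
    exact hG.four_cycle s c t k hsc htc.symm htk hsk.symm hst (hcx k hk) hn (hcK k hk)
  push Not at hno
  rcases hK.short_path hG hs ht hno with
    ⟨x, hx, y, hy, hsx, hty, hxy⟩ | ⟨x, hx, z, hz, y, hy, hsx, hxz, hzy, hty, hsz, htz, hxy⟩
  · exact hG.five_cycle s c t y x hsc htc.symm hty hxy.symm hsx.symm hn (hcK y hy)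
      (hno x hx hsx) (fun h => hno y hy h.symm hty) (fun h => hcK x hx h.symm)
  · refine hG.private_pairs s y c x t z hsc hsx hty.symm hzy.symm (hcx x hx)
      (fun h => hK.disjoint z hz (h ▸ ht)) (fun h => hno y hy h hty) hn hsz
      (fun h => hcK y hy h.symm) fun h => hxy h.symm

/-- Nonadjacent `s`, `t` without a common neighbor in `K` or `L` would each have private neighbors
in both. -/
lemma IsFullComponent.isClique {V : Type*} {G : SimpleGraph V} (hG : PatternFree G)
    {S K L : Set V} (hK : IsFullComponent G S K) (hL : IsFullComponent G S L)
    (hKL : Disjoint K L) : G.IsClique S := by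
  intro s hs t ht hst
  by_cases h1 : ∃ k ∈ K, G.Adj s k ∧ G.Adj t k
  · obtain ⟨k, hk, hsk, htk⟩ := h1
    exact hL.adj_of_common hG hK hKL.symm hs ht hst hk hsk htk
  by_cases h2 : ∃ k ∈ L, G.Adj s k ∧ G.Adj t k
  · obtain ⟨k, hk, hsk, htk⟩ := h2
    exact hK.adj_of_common hG hL hKL hs ht hst hk hsk htk
  push Not at h1 h2
  by_contra hn
  obtain ⟨k, hk, hsk⟩ := hK.full s hs
  obtain ⟨k', hk', htk'⟩ := hK.full t ht
  obtain ⟨l, hl, hsl⟩ := hL.full s hs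
  obtain ⟨l', hl', htl'⟩ := hL.full t ht
  exact hG.private_pairs s t k l k' l' hsk hsl htk' htl'
    (fun h => Set.disjoint_left.1 hKL hk (h ▸ hl))
    (fun h => Set.disjoint_left.1 hKL hk' (h ▸ hl')) hn
    (fun h => h1 k' hk' h htk') (fun h => h2 l' hl' h htl') (h1 k hk hsk) (h2 l hl hsl)

/-- Otherwise the edge `s t` closes a short path to an induced 4- or 5-cycle. -/
lemma IsFullComponent.exists_common {V : Type*} {G : SimpleGraph V} (hG : PatternFree G)
    {S K : Set V} (hK : IsFullComponent G S K) {s t : V} (hs : s ∈ S) (ht : t ∈ S)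
    (hst : G.Adj s t) : ∃ k ∈ K, G.Adj s k ∧ G.Adj t k := by
  by_contra! hno
  rcases hK.short_path hG hs ht hno with
    ⟨x, hx, y, hy, hsx, hty, hxy⟩ | ⟨x, hx, z, hz, y, hy, hsx, hxz, hzy, hty, hsz, htz, hxy⟩
  · exact hG.four_cycle s x y t hsx hxy hty.symm hst.symm
      (fun h => hK.disjoint y hy (h ▸ hs)) (fun h => hK.disjoint x hx (h ▸ ht))
      (fun h => hno y hy h hty) fun h => hno x hx hsx h.symm
  · exact hG.five_cycle s x z y t hsx hxz hzy hty.symm hst.symm hsz hxy (fun h => htz h.symm)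
      (fun h => hno y hy h.symm hty) (hno x hx hsx)

/-- A minimal separator `S` as it occurs below: `G - S` has two full components. -/
def HasTwoFullComponents {V : Type*} (G : SimpleGraph V) (S : Set V) : Prop :=
  ∃ K L, IsFullComponent G S K ∧ IsFullComponent G S L ∧ Disjoint K L

lemma HasTwoFullComponents.exists_avoiding {V : Type*} {G : SimpleGraph V} {S T : Set V}
    (hS : HasTwoFullComponents G S) (hT : G.IsClique T) :
    ∃ K, IsFullComponent G S K ∧ Disjoint K T := by
  obtain ⟨K, L, hK, hL, hKL⟩ := hS
  by_cases h : Disjoint K T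
  · exact ⟨K, hK, h⟩
  obtain ⟨x, hxK, hxT⟩ := Set.not_disjoint_iff.1 h
  refine ⟨L, hL, Set.disjoint_left.2 fun y hyL hyT => hK.not_adj hL hKL hxK hyL
    (hT hxT hyT fun h => Set.disjoint_left.1 hKL hxK (h ▸ hyL))⟩

lemma HasTwoFullComponents.isClique {V : Type*} {G : SimpleGraph V} (hG : PatternFree G) {S : Set V}
    (hS : HasTwoFullComponents G S) : G.IsClique S := by
  obtain ⟨K, L, hK, hL, hKL⟩ := hS
  exact hK.isClique hG hL hKL

/-- Full components `K` of `S` avoiding `T` and `L` of `T` avoiding `S` supply common neighbors `a`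
of `s, s'` and `b` of `t, t'`. An edge `a b` would put `a`, and then `s`, into `L`. -/
lemma HasTwoFullComponents.not_two_two {V : Type*} {G : SimpleGraph V} (hG : PatternFree G)
    {S T : Set V} (hS : HasTwoFullComponents G S) (hT : HasTwoFullComponents G T) {s s' t t' : V}
    (hs : s ∈ S \ T) (hs' : s' ∈ S \ T) (ht : t ∈ T \ S) (ht' : t' ∈ T \ S) (hss : s ≠ s')
    (htt : t ≠ t') : False := by
  have cS := hS.isClique hG
  have cT := hT.isClique hG
  obtain ⟨K, hK, hKT⟩ := hS.exists_avoiding cT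
  obtain ⟨L, hL, hLS⟩ := hT.exists_avoiding cS
  rw [Set.disjoint_left] at hKT hLS
  obtain ⟨a, ha, hsa, hsa'⟩ := hK.exists_common hG hs.1 hs'.1 (cS hs.1 hs'.1 hss)
  obtain ⟨b, hb, htb, htb'⟩ := hL.exists_common hG ht.1 ht'.1 (cT ht.1 ht'.1 htt)
  refine hG.private_pairs a b s s' t t' hsa.symm hsa'.symm htb.symm htb'.symm hss htt
    (fun hab => ?_) (fun h => hKT (hK.closed a ha t ht.2 h) ht.1)
    (fun h => hKT (hK.closed a ha t' ht'.2 h) ht'.1)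
    (fun h => hLS (hL.closed b hb s hs.2 h) hs.1) fun h => hLS (hL.closed b hb s' hs'.2 h) hs'.1
  have hbK : b ∈ K := hK.closed a ha b (hLS hb) hab
  have haL : a ∈ L := hL.closed b hb a (hKT ha) hab.symm
  exact hLS (hL.closed a haL s hs.2 hsa.symm) hs.1

/-! ### From minimal obstructions to separators. -/

lemma SimpleGraph.Reachable.exists_adj_of_mem_of_notMem {V : Type*} {G : SimpleGraph V} {u v : V}
    (h : G.Reachable u v) {A : Set V} (hu : u ∈ A) (hv : v ∉ A) :
    ∃ x ∈ A, ∃ y ∉ A, G.Adj x y ∧ G.Reachable u y := by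
  obtain ⟨p⟩ := h
  obtain ⟨d, hd, h1, h2⟩ := p.exists_boundary_dart A hu hv
  classical
  exact ⟨d.fst, h1, d.snd, h2, d.adj,
    (p.takeUntil d.snd (p.dart_snd_mem_support_of_mem_darts hd)).reachable⟩

lemma exists_adj_of_connected_induce {V : Type*} {G : SimpleGraph V} {D A : Set V}
    (hD : (G.induce D).Connected) (hAD : A ⊆ D) (hA : A.Nonempty) (hDA : ¬ D ⊆ A) :
    ∃ x ∈ A, ∃ y ∈ D, y ∉ A ∧ G.Adj x y := by
  obtain ⟨a, ha⟩ := hA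
  obtain ⟨b, hb, hbA⟩ := Set.not_subset.1 hDA
  obtain ⟨x, hx, y, hy, hxy, -⟩ := (hD.preconnected ⟨a, hAD ha⟩ ⟨b, hb⟩).exists_adj_of_mem_of_notMem
    (A := Subtype.val ⁻¹' A) ha hbA
  exact ⟨x, hx, y, y.2, hy, hxy⟩

lemma IsConnectedDominatingSet.mono {V : Type*} {G : SimpleGraph V} {D E : Set V}
    (hD : IsConnectedDominatingSet G D) (hDE : D ⊆ E) : IsConnectedDominatingSet G E := by
  refine ⟨fun v => (hD.1 v).imp (@hDE v) fun ⟨u, hu, h⟩ => ⟨u, hDE hu, h⟩, ?_⟩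
  obtain ⟨⟨a, ha⟩⟩ := hD.2.nonempty
  have inner : ∀ u (hu : u ∈ D), (G.induce E).Reachable ⟨a, hDE ha⟩ ⟨u, hDE hu⟩ := fun u hu =>
    (hD.2.preconnected ⟨a, ha⟩ ⟨u, hu⟩).map (SimpleGraph.induceHomOfLE G hDE).toHom
  rw [SimpleGraph.connected_iff_exists_forall_reachable]
  refine ⟨⟨a, hDE ha⟩, fun ⟨v, hv⟩ => ?_⟩
  rcases hD.1 v with h | ⟨u, hu, h⟩
  · exact inner v h
  · have : (G.induce E).Adj ⟨u, hDE hu⟩ ⟨v, hv⟩ := h.symm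
    exact (inner u hu).trans this.reachable

/-- The complement of `S` still dominates, so it must be disconnected; since restoring any `s`
reconnects it, `s` has a neighbor in every component. -/
lemma hasTwoFullComponents_of_minimal {V : Type*} {G : SimpleGraph V} {S : Set V}
    (hne : Sᶜ.Nonempty) (hS : ¬ IsConnectedDominatingSet G Sᶜ)
    (hmin : ∀ s ∈ S, IsConnectedDominatingSet G (insert s Sᶜ)) : HasTwoFullComponents G S := by
  have hdom : IsDominatingSet G Sᶜ := by
    intro v
    by_cases hv : v ∈ S
    · obtain ⟨z, hz⟩ := hne
      obtain ⟨x, hx, y, hy, hyx, hxy⟩ := exists_adj_of_connected_induce (hmin v hv).2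
        (A := {v}) (by simp) ⟨v, rfl⟩ fun h => hz (h (Or.inr hz) ▸ hv)
      rw [Set.mem_singleton_iff] at hx
      subst hx
      exact Or.inr ⟨y, hy.resolve_left hyx, hxy⟩
    · exact Or.inl hv
  have hcon : ¬ (G.induce Sᶜ).Preconnected := fun h =>
    have := hne.to_subtype
    hS ⟨hdom, ⟨h⟩⟩
  simp only [SimpleGraph.Preconnected, not_forall] at hcon
  obtain ⟨x, y, hxy⟩ := hcon
  set comp : (Sᶜ : Set V) → Set V :=
    fun a => {v | ∃ h : v ∈ Sᶜ, (G.induce Sᶜ).Reachable a ⟨v, h⟩} with hcomp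
  have hdisj : Disjoint (comp x) (comp y) := Set.disjoint_left.2 fun v ⟨_, h⟩ ⟨_, h'⟩ =>
    hxy (h.trans h'.symm)
  have closed : ∀ a, ∀ u ∈ comp a, ∀ v, v ∉ S → G.Adj u v → v ∈ comp a := by
    rintro a u ⟨hu, hr⟩ v hv huv
    have : (G.induce Sᶜ).Adj ⟨u, hu⟩ ⟨v, hv⟩ := huv
    exact ⟨hv, hr.trans this.reachable⟩
  have full : ∀ a b, Disjoint (comp a) (comp b) → IsFullComponent G S (comp a) := by
    intro a b hab
    refine ⟨⟨a, a.2, .refl _⟩, fun v hv => hv.1, closed a, ?_, ?_⟩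
    · rintro A hA ⟨p, hp⟩ hn
      obtain ⟨q, hq, hqA⟩ := Set.not_subset.1 hn
      obtain ⟨hp', hap⟩ := hA hp
      obtain ⟨hq', haq⟩ := hq
      obtain ⟨u, hu, v, hv, huv, hr⟩ := (hap.symm.trans haq).exists_adj_of_mem_of_notMem
        (A := Subtype.val ⁻¹' A) hp hqA
      exact ⟨u, hu, v, ⟨v.2, hap.trans hr⟩, hv, huv⟩
    · intro s hs
      obtain ⟨u, hu, v, hv, hvn, huv⟩ := exists_adj_of_connected_induce (hmin s hs).2
        (A := comp a) (fun v hv => Or.inr hv.1) ⟨a, a.2, .refl _⟩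
        fun h => Set.disjoint_left.1 hab (h (Or.inr b.2)) ⟨b.2, .refl _⟩
      rcases hv with rfl | hv
      · exact ⟨u, hu, huv.symm⟩
      · exact absurd (closed a u hu v hv huv) hvn
  exact ⟨comp x, comp y, full x y hdisj, full y x hdisj.symm, hdisj⟩

/-- The minimal sets whose complement is not a connected dominating set form a 1-Sperner
hypergraph. -/
lemma PatternFree.isOneSperner {V : Type*} [Fintype V] [DecidableEq V] {G : SimpleGraph V}
    (hG : PatternFree G) {H : Finset (Finset V)}
    (hH : ∀ S ∈ H, Minimal (fun S : Finset V => ¬ IsConnectedDominatingSet G (↑Sᶜ : Set V)) S) :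
    IsOneSperner H := by
  have two : ∀ S ∈ H, ∀ T ∈ H, S ≠ T → HasTwoFullComponents G (S : Set V) := by
    intro S hS T hT hne
    refine hasTwoFullComponents_of_minimal ?_ (by simpa using (hH S hS).prop) fun s hs => ?_
    -- The whole vertex set can be minimal only if it is the sole hyperedge.
    · rw [Set.nonempty_compl]
      intro h
      have : S = Finset.univ := by simpa using h
      exact hne ((hH S hS).eq_of_le (hH T hT).prop (this ▸ Finset.subset_univ T)).symm
    · have := (hH S hS).not_prop_of_lt (Finset.erase_ssubset hs)
      rw [not_not, Finset.compl_erase] at this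
      simpa using this
  intro S hS T hT hne
  have h1 : 0 < (S \ T).card := Finset.card_pos.2 (Finset.sdiff_nonempty.2 fun h =>
    hne ((hH T hT).eq_of_le (hH S hS).prop h))
  have h2 : 0 < (T \ S).card := Finset.card_pos.2 (Finset.sdiff_nonempty.2 fun h =>
    hne ((hH S hS).eq_of_le (hH T hT).prop h).symm)
  by_contra hcon
  obtain ⟨s, hs, s', hs', hss⟩ := Finset.one_lt_card.1 (show 1 < (S \ T).card by omega)
  obtain ⟨t, ht, t', ht', htt⟩ := Finset.one_lt_card.1 (show 1 < (T \ S).card by omega)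
  rw [← Finset.mem_coe, Finset.coe_sdiff] at hs hs' ht ht'
  exact (two S hS T hT hne).not_two_two hG (two T hT S hS hne.symm) hs hs' ht ht' hss htt

/-! ### Weights for connected dominating sets. -/

theorem PatternFree.isConnectedDomishold {V : Type*} [Finite V] {G : SimpleGraph V}
    (hG : PatternFree G) : IsConnectedDomishold G := by
  classical
  have := Fintype.ofFinite V
  set P : Finset V → Prop := fun S => ¬ IsConnectedDominatingSet G (↑Sᶜ : Set V) with hP
  obtain ⟨w, t, hw, ht, h⟩ := (hG.isOneSperner (H := Finset.univ.filter (Minimal P))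
    fun S hS => (Finset.mem_filter.1 hS).2).exists_isThresholdFor
  have hcds : ∀ D : Finset V,
      IsConnectedDominatingSet G (D : Set V) ↔ ∑ x, w x - t < ∑ x ∈ D, w x := by
    intro D
    have h1 : t ≤ ∑ x ∈ Dᶜ, w x ↔ ¬ IsConnectedDominatingSet G (D : Set V) := by
      rw [h]
      constructor
      · rintro ⟨e, he, hs⟩ hD
        refine (Finset.mem_filter.1 he).2.prop (hD.mono ?_)
        exact Finset.coe_subset.2 fun x hx =>
          Finset.mem_compl.2 fun hxe => Finset.mem_compl.1 (hs hxe) hx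
      · intro hD
        obtain ⟨e, hle, he⟩ := (Set.toFinite {S | P S}).exists_le_minimal (a := Dᶜ)
          (by simpa [hP] using hD)
        exact ⟨e, by simpa using he, hle⟩
    rw [← not_iff_not, ← h1, ← Finset.sum_add_sum_compl D]
    constructor <;> intro h <;> linarith
  -- The threshold is nonnegative because the empty set is not connected dominating.
  have hempty : 0 ≤ ∑ x, w x - t := by
    by_contra! hlt
    obtain ⟨⟨_, hv⟩⟩ := ((hcds ∅).2 (by simpa using hlt)).2.nonempty
    simp at hv
  -- Only finitely many sums occur, so a small `ε` turns the strict inequality of `hcds` into a weak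
  -- one.
  have hgap : ∀ᶠ ε in nhdsWithin (0 : ℝ) (Set.Ioi 0), ∀ D : Finset V,
      ∑ x, w x - t < ∑ x ∈ D, w x → ε < ∑ x ∈ D, w x - (∑ x, w x - t) :=
    Filter.eventually_all.2 fun D => by
      by_cases hD : ∑ x, w x - t < ∑ x ∈ D, w x
      · filter_upwards [nhdsWithin_le_nhds (Iio_mem_nhds (sub_pos.2 hD))] with ε hε _ using hε
      · exact Filter.Eventually.of_forall fun _ h' => absurd h' hD
  obtain ⟨ε, hε, hε0⟩ := (hgap.and self_mem_nhdsWithin).exists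
  refine ⟨w, ∑ x, w x - t + ε, fun v => (hw v).le, by linarith, fun D => ?_⟩
  rw [hcds]
  exact ⟨fun h' => by linarith, fun h' => by linarith [hε D h']⟩

theorem mainTheorem11 {V : Type*} [Finite V] (G : SimpleGraph V)
    (hG : IsHereditarilyTotalDomishold G) : IsHereditarilyConnectedDomishold G :=
  fun U => (hG.patternFree.induce U).isConnectedDomishold
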